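/- Theorem 3.2. For a real number $c$, let $\mathcal{T}_c\colon L^2[0,\infty)\to L^2[0,\infty)$ be the Airy integral operator $$\mathcal{T}_c[f](x)=\int_0^\infty \mathrm{Ai}(x+y+c)\,f(y)\,dy,\qquad x\ge 0,$$ where $\mathrm{Ai}(x)=\frac1\pi\int_0^\infty\cos\bigl(\tfrac{t^3}{3}+xt\bigr)\,dt$ (a conditionally convergent improper integral) is the Airy function of the first kind. For $a>0$ and $k=0,1,2,\dots$, let $h_k^a(x)=\sqrt a\,e^{-ax/2}L_k(ax)$ be the scaled Laguerre functions, where the Laguerre polynomials are given by $L_0(x)=1$, $L_1(x)=1-x$ and $(k+1)L_{k+1}(x)=(2k+1-x)L_k(x)-kL_{k-1}(x)$ for $k\ge1$. Let $a,c\in\mathbb{R}$ with $a>0$, and let $\psi$ be any real-valued eigenfunction of $\mathcal{T}_c$, that is, $\psi\in L^2[0,\infty)$, $\psi\neq0$, and $\mathcal{T}_c[\psi]=\lambda\psi$ for some $\lambda\in\mathbb{R}$. (In particular, $\psi$ may be the $(m+1)$-th eigenfunction $\psi_{m,c}$, $m\ge 0$, in the order of decreasing absolute value of the eigenvalues, normalized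 by $\|\psi_{m,c}\|_{L^2[0,\infty)}=1$ and $\psi_{m,c}(0)>0$.) Put $$\beta_k=\int_0^\infty \psi(x)\,h_k^a(x)\,dx,\qquad k=0,1,2,\dots.$$ Then $|\beta_k|$ decays super-algebraically as $k\to\infty$: for every non-negative integer $N$, $\lim_{k\to\infty}k^{N}|\beta_k|=0$. -/

import Mathlib

open MeasureTheory Set Filter Topology

noncomputable section

/-- The Airy function of the first kind on the real line, by its (conditionally convergent)
integral representation `Ai(x) = (1/π) ∫₀^∞ cos(t³/3 + x t) dt`; the improper integral is the
limit of the integrals over `[0, R]` as `R → ∞`, which exists for every real `x`. -/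
def airyAi (x : ℝ) : ℝ :=
  (1 / Real.pi) * limUnder atTop (fun R : ℝ => ∫ t in (0 : ℝ)..R, Real.cos (t ^ 3 / 3 + x * t))

/-- The Airy integral operator with parameter `c`:
`T_c[f](x) = ∫₀^∞ Ai(x + y + c) f(y) dy`. -/
def airyOperator (c : ℝ) (f : ℝ → ℝ) (x : ℝ) : ℝ :=
  ∫ y in Ioi (0 : ℝ), airyAi (x + y + c) * f y

/-- `ψ` represents an eigenfunction of `T_c` on `L²[0,∞)`: it is square integrable on the half
line, it is not the zero element of `L²[0,∞)`, and `T_c ψ = μ ψ` in `L²[0,∞)` for some real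
number `μ`. No sign, normalization or continuity of the representative is required, and `μ` is
not assumed to be nonzero. -/
structure IsAiryEigenfunction (c : ℝ) (ψ : ℝ → ℝ) : Prop where
  memLp : MemLp ψ 2 (volume.restrict (Ioi (0 : ℝ)))
  ne_zero : ¬ ψ =ᵐ[volume.restrict (Ioi (0 : ℝ))] 0
  eigen : ∃ μ : ℝ, ∀ᵐ x ∂(volume.restrict (Ioi (0 : ℝ))), airyOperator c ψ x = μ * ψ x

/-- The Laguerre polynomials, by their three-term recurrence
`(k + 1) L_{k+1}(x) = (2k + 1 - x) L_k(x) - k L_{k-1}(x)`, `L_0 = 1`, `L_1 = 1 - x`. -/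
def laguerreL : ℕ → ℝ → ℝ
  | 0, _ => 1
  | 1, x => 1 - x
  | k + 2, x =>
      ((2 * ((k : ℝ) + 1) + 1 - x) * laguerreL (k + 1) x - ((k : ℝ) + 1) * laguerreL k x)
        / ((k : ℝ) + 2)

/-- The scaled Laguerre functions `h_n^a(x) = √a e^{-ax/2} L_n(ax)`. -/
def scaledLaguerre (a : ℝ) (n : ℕ) (x : ℝ) : ℝ :=
  Real.sqrt a * Real.exp (-(a * x) / 2) * laguerreL n (a * x)

/-- The `k`-th expansion coefficient `∫₀^∞ ψ(x) h_k^a(x) dx` of `ψ`. -/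
def laguerreCoeff (a : ℝ) (ψ : ℝ → ℝ) (k : ℕ) : ℝ :=
  ∫ x in Ioi (0 : ℝ), ψ x * scaledLaguerre a k x

end

/-! Two facts combine: an eigenfunction is smooth on the half line with rapidly decaying
derivatives, and the Laguerre coefficients of any such function decay super-algebraically.

Smoothness: moving the contour of the Airy integral to `ℝ + i` gives the integrand modulus
proportional to `exp (-t ^ 2)` (`airyAi_eq_integral`). Fubini turns `T_c ψ` into `∫ H(t) e^{ix(t+i)}
dt`, where `H` is a Gaussian-size factor times a bounded function
(`airyOperator_eq_shiftedFourier`). This is entire in `x`, and on `x ≥ 0` every derivative is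
`O(e^{-x})`. It remains to divide by the eigenvalue. It is nonzero because `T_c` is injective: if
`T_c ψ` vanishes on the half line, analyticity and Fourier uniqueness force `H = 0`, hence `ψ = 0`.

Decay: the Laguerre functions are eigenfunctions of the symmetric operator `Lf = -(x f')' + (a²x/4)
f` with eigenvalues `a (k + 1/2)`. Hence `(a (k + 1/2))^N β_k` is the `k`-th coefficient of `L^N f`,
which is bounded in `k` since the Laguerre functions have norm at most one. -/

/-! ### Laguerre polynomials: derivative identities and the differential equation -/

/-- The derivative of the Laguerre polynomial `laguerreL k`. -/
noncomputable def laguerreDeriv : ℕ → ℝ → ℝ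
  | 0, _ => 0
  | k + 1, x => laguerreDeriv k x - laguerreL k x

theorem laguerreL_recurrence (k : ℕ) (x : ℝ) :
    ((k : ℝ) + 2) * laguerreL (k + 2) x
      = (2 * ((k : ℝ) + 1) + 1 - x) * laguerreL (k + 1) x - ((k : ℝ) + 1) * laguerreL k x := by
  have : (k : ℝ) + 2 ≠ 0 := by positivity
  rw [laguerreL]
  field_simp

/-- Purely algebraic: induction from the three-term recurrence, before `laguerreDeriv` is known to
be a derivative. -/
theorem mul_laguerreDeriv_succ (k : ℕ) (x : ℝ) :
    x * laguerreDeriv (k + 1) x = ((k : ℝ) + 1) * (laguerreL (k + 1) x - laguerreL k x) := by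
  induction k with
  | zero => simp [laguerreDeriv, laguerreL]
  | succ k ih =>
    have h := laguerreL_recurrence k x
    rw [laguerreDeriv]
    push_cast
    linear_combination ih - h

theorem hasDerivAt_laguerreL (k : ℕ) (x : ℝ) :
    HasDerivAt (laguerreL k) (laguerreDeriv k x) x := by
  induction k using Nat.twoStepInduction with
  | zero =>
    have : laguerreL 0 = fun _ => 1 := by ext; simp [laguerreL]
    rw [this]
    simpa [laguerreDeriv] using hasDerivAt_const x (1 : ℝ)
  | one =>
    have : laguerreL 1 = fun x => 1 - x := by ext; simp [laguerreL]
    rw [this]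
    simpa [laguerreDeriv, laguerreL] using (hasDerivAt_id x).const_sub 1
  | more k h0 h1 =>
    have h2 : (k : ℝ) + 2 ≠ 0 := by positivity
    have key := ((((hasDerivAt_id x).const_sub (2 * ((k : ℝ) + 1) + 1)).mul h1).sub
      (h0.const_mul ((k : ℝ) + 1))).div_const ((k : ℝ) + 2)
    have hfun : laguerreL (k + 2) = fun x =>
        ((2 * ((k : ℝ) + 1) + 1 - x) * laguerreL (k + 1) x - ((k : ℝ) + 1) * laguerreL k x)
          / ((k : ℝ) + 2) := by
      ext; rw [laguerreL]
    rw [hfun]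
    refine key.congr_deriv ?_
    rw [div_eq_iff h2]
    have hm := mul_laguerreDeriv_succ k x
    have hd : laguerreDeriv (k + 2) x = laguerreDeriv (k + 1) x - laguerreL (k + 1) x := rfl
    have hd' : laguerreDeriv (k + 1) x = laguerreDeriv k x - laguerreL k x := rfl
    simp only [id]
    rw [hd]
    linear_combination -hm + ((k : ℝ) + 1) * hd'

/-- The Laguerre equation in self-adjoint form. -/
theorem hasDerivAt_mul_laguerreDeriv (k : ℕ) (x : ℝ) :
    HasDerivAt (fun x => x * laguerreDeriv k x) (x * laguerreDeriv k x - k * laguerreL k x) x := by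
  cases k with
  | zero => simpa [laguerreDeriv] using hasDerivAt_const x (0 : ℝ)
  | succ k =>
    -- In this form only first derivatives of Laguerre polynomials are needed.
    have hfun : (fun x => x * laguerreDeriv (k + 1) x)
        = fun x => ((k : ℝ) + 1) * (laguerreL (k + 1) x - laguerreL k x) :=
      funext (mul_laguerreDeriv_succ k)
    rw [hfun]
    refine (((hasDerivAt_laguerreL (k + 1) x).sub (hasDerivAt_laguerreL k x)).const_mul
      ((k : ℝ) + 1)).congr_deriv ?_
    rw [mul_laguerreDeriv_succ, laguerreDeriv]
    push_cast
    ring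

theorem laguerreL_zero_right (k : ℕ) : laguerreL k 0 = 1 := by
  induction k with
  | zero => simp [laguerreL]
  | succ k ih =>
    have h := mul_laguerreDeriv_succ k 0
    have hk : (k : ℝ) + 1 ≠ 0 := by positivity
    rw [zero_mul, eq_comm, mul_eq_zero, or_iff_right hk] at h
    linarith

/-! ### Polynomial bounds on the half line -/

/-- A function bounded by a polynomial on the half line `[0, ∞)`. -/
def PolyBoundedOnHalfLine (u : ℝ → ℝ) : Prop :=
  ∃ C n, ∀ x, 0 ≤ x → |u x| ≤ C * (1 + x) ^ (n : ℕ)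

namespace PolyBoundedOnHalfLine

theorem const (c : ℝ) : PolyBoundedOnHalfLine fun _ => c := ⟨|c|, 0, by simp⟩

theorem id : PolyBoundedOnHalfLine fun x => x :=
  ⟨1, 1, fun x hx => by rw [abs_of_nonneg hx]; linarith⟩

theorem mul {u v : ℝ → ℝ} (hu : PolyBoundedOnHalfLine u) (hv : PolyBoundedOnHalfLine v) :
    PolyBoundedOnHalfLine fun x => u x * v x := by
  obtain ⟨C, n, hC⟩ := hu
  obtain ⟨D, m, hD⟩ := hv
  refine ⟨C * D, n + m, fun x hx => ?_⟩
  rw [abs_mul, pow_add, mul_mul_mul_comm]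
  exact mul_le_mul (hC x hx) (hD x hx) (abs_nonneg _) ((abs_nonneg _).trans (hC x hx))

theorem add {u v : ℝ → ℝ} (hu : PolyBoundedOnHalfLine u) (hv : PolyBoundedOnHalfLine v) :
    PolyBoundedOnHalfLine fun x => u x + v x := by
  obtain ⟨C, n, hC⟩ := hu
  obtain ⟨D, m, hD⟩ := hv
  refine ⟨|C| + |D|, n + m, fun x hx => ?_⟩
  have h1 : (1 + x) ^ n ≤ (1 + x) ^ (n + m) := pow_le_pow_right₀ (by linarith) (by omega)
  have h2 : (1 + x) ^ m ≤ (1 + x) ^ (n + m) := pow_le_pow_right₀ (by linarith) (by omega)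
  have h3 : C * (1 + x) ^ n ≤ |C| * (1 + x) ^ (n + m) :=
    mul_le_mul (le_abs_self C) h1 (by positivity) (abs_nonneg _)
  have h4 : D * (1 + x) ^ m ≤ |D| * (1 + x) ^ (n + m) :=
    mul_le_mul (le_abs_self D) h2 (by positivity) (abs_nonneg _)
  have := abs_add_le (u x) (v x)
  have := hC x hx
  have := hD x hx
  rw [add_mul]
  linarith

theorem sub {u v : ℝ → ℝ} (hu : PolyBoundedOnHalfLine u) (hv : PolyBoundedOnHalfLine v) :
    PolyBoundedOnHalfLine fun x => u x - v x := by
  simpa [sub_eq_add_neg] using hu.add ((const (-1)).mul hv)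

end PolyBoundedOnHalfLine

theorem polyBounded_laguerreL {a : ℝ} (k : ℕ) :
    PolyBoundedOnHalfLine fun x => laguerreL k (a * x) := by
  have ha : PolyBoundedOnHalfLine fun x => a * x := .mul (.const a) .id
  induction k using Nat.twoStepInduction with
  | zero => simpa [laguerreL] using PolyBoundedOnHalfLine.const 1
  | one => simpa [laguerreL] using PolyBoundedOnHalfLine.sub (.const 1) ha
  | more k h0 h1 =>
    simp only [laguerreL, div_eq_mul_inv]
    exact ((((PolyBoundedOnHalfLine.const _).sub ha).mul h1).sub
      ((PolyBoundedOnHalfLine.const _).mul h0)).mul (.const _)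

theorem polyBounded_laguerreDeriv {a : ℝ} (k : ℕ) :
    PolyBoundedOnHalfLine fun x => laguerreDeriv k (a * x) := by
  induction k with
  | zero => simpa [laguerreDeriv] using PolyBoundedOnHalfLine.const 0
  | succ k ih => simpa only [laguerreDeriv] using ih.sub (polyBounded_laguerreL k)

theorem polyBounded_exp {a : ℝ} (ha : 0 ≤ a) :
    PolyBoundedOnHalfLine fun x => Real.exp (-(a * x) / 2) := by
  refine ⟨1, 0, fun x hx => ?_⟩
  rw [abs_of_nonneg (Real.exp_pos _).le, pow_zero, mul_one, Real.exp_le_one_iff]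
  have := mul_nonneg ha hx
  linarith

/-! ### Scaled Laguerre functions: Sturm–Liouville equation and norm bound -/

/-- The derivative of the scaled Laguerre function, multiplied by `x`. -/
noncomputable def scaledLaguerreMulDeriv (a : ℝ) (k : ℕ) (x : ℝ) : ℝ :=
  Real.sqrt a * Real.exp (-(a * x) / 2)
    * ((a * x) * laguerreDeriv k (a * x) - (a * x) / 2 * laguerreL k (a * x))

theorem hasDerivAt_exp_neg_mul_div_two (a x : ℝ) :
    HasDerivAt (fun x => Real.sqrt a * Real.exp (-(a * x) / 2))
      (-a / 2 * (Real.sqrt a * Real.exp (-(a * x) / 2))) x := by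
  have h := ((((hasDerivAt_id x).const_mul a).neg.div_const 2).exp).const_mul (Real.sqrt a)
  refine h.congr_deriv ?_
  simp only [id, mul_one, Pi.neg_apply]
  ring

theorem hasDerivAt_const_mul_self (a x : ℝ) : HasDerivAt (fun x => a * x) a x := by
  simpa using (hasDerivAt_id x).const_mul a

theorem hasDerivAt_scaledLaguerre (a : ℝ) (k : ℕ) (x : ℝ) :
    HasDerivAt (scaledLaguerre a k)
      (Real.sqrt a * Real.exp (-(a * x) / 2)
        * (a * laguerreDeriv k (a * x) - a / 2 * laguerreL k (a * x))) x := by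
  have h := (hasDerivAt_exp_neg_mul_div_two a x).mul
    ((hasDerivAt_laguerreL k (a * x)).comp x (hasDerivAt_const_mul_self a x))
  refine h.congr_deriv ?_
  simp only [Function.comp]
  ring

theorem continuous_scaledLaguerre (a : ℝ) (k : ℕ) : Continuous (scaledLaguerre a k) :=
  continuous_iff_continuousAt.2 fun x => (hasDerivAt_scaledLaguerre a k x).continuousAt

/-- The Sturm–Liouville equation for `h_k`, in which the eigenvalue `a (k + 1/2)` appears. -/
theorem hasDerivAt_scaledLaguerreMulDeriv (a : ℝ) (k : ℕ) (x : ℝ) :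
    HasDerivAt (scaledLaguerreMulDeriv a k)
      ((a ^ 2 * x / 4 - a * (k + 1 / 2)) * scaledLaguerre a k x) x := by
  have h1 := (hasDerivAt_mul_laguerreDeriv k (a * x)).comp x (hasDerivAt_const_mul_self a x)
  have h2 := ((hasDerivAt_const_mul_self a x).div_const 2).mul
    ((hasDerivAt_laguerreL k (a * x)).comp x (hasDerivAt_const_mul_self a x))
  have h := (hasDerivAt_exp_neg_mul_div_two a x).mul (h1.sub h2)
  refine h.congr_deriv ?_
  simp only [Function.comp, scaledLaguerre, Pi.sub_apply, Pi.mul_apply]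
  ring

theorem polyBounded_scaledLaguerre {a : ℝ} (ha : 0 ≤ a) (k : ℕ) :
    PolyBoundedOnHalfLine (scaledLaguerre a k) :=
  ((PolyBoundedOnHalfLine.const _).mul (polyBounded_exp ha)).mul (polyBounded_laguerreL k)

theorem polyBounded_scaledLaguerreMulDeriv {a : ℝ} (ha : 0 ≤ a) (k : ℕ) :
    PolyBoundedOnHalfLine (scaledLaguerreMulDeriv a k) := by
  have hx : PolyBoundedOnHalfLine fun x => a * x := .mul (.const a) .id
  have hx2 : PolyBoundedOnHalfLine fun x => a * x / 2 := by
    simpa only [div_eq_mul_inv] using hx.mul (.const 2⁻¹)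
  exact ((PolyBoundedOnHalfLine.const _).mul (polyBounded_exp ha)).mul
    ((hx.mul (polyBounded_laguerreDeriv k)).sub (hx2.mul (polyBounded_laguerreL k)))

/-- Orthonormality is not needed. Since `(h_{k+1} - h_k)' = -(a/2) (h_{k+1} + h_k)`, the difference
`h_{k+1}² - h_k²` is the derivative of `-(1/a) (h_{k+1} - h_k)²`, which vanishes at `0`. So the
truncated integrals do not increase with `k`. -/
theorem integral_scaledLaguerre_sq_le_one {a : ℝ} (ha : 0 < a) (k : ℕ) (R : ℝ) :
    ∫ x in (0 : ℝ)..R, scaledLaguerre a k x ^ 2 ≤ 1 := by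
  induction k with
  | zero =>
    have hd : ∀ x ∈ uIcc 0 R, HasDerivAt (fun x => -Real.exp (-(a * x)))
        (scaledLaguerre a 0 x ^ 2) x := by
      intro x _
      refine (hasDerivAt_const_mul_self a x).neg.exp.neg.congr_deriv ?_
      rw [scaledLaguerre, laguerreL, mul_one, mul_pow, Real.sq_sqrt ha.le, ← Real.exp_nat_mul]
      have : ((2 : ℕ) : ℝ) * (-(a * x) / 2) = -(a * x) := by push_cast; ring
      rw [this]
      simp only [Pi.neg_apply]
      ring
    rw [intervalIntegral.integral_eq_sub_of_hasDerivAt hd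
      (((continuous_scaledLaguerre a 0).pow 2).intervalIntegrable _ _)]
    have := Real.exp_pos (-(a * R))
    simp
    linarith
  | succ k ih =>
    have hd : ∀ x ∈ uIcc 0 R,
        HasDerivAt (fun x => -(1 / a) * (scaledLaguerre a (k + 1) x - scaledLaguerre a k x) ^ 2)
          (scaledLaguerre a (k + 1) x ^ 2 - scaledLaguerre a k x ^ 2) x := by
      intro x _
      have h := (((hasDerivAt_scaledLaguerre a (k + 1) x).sub
        (hasDerivAt_scaledLaguerre a k x)).pow 2).const_mul (-(1 / a))
      refine h.congr_deriv ?_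
      simp only [scaledLaguerre, laguerreDeriv, Pi.sub_apply]
      field_simp
      push_cast
      ring
    have hc : ∀ j, IntervalIntegrable (fun x => scaledLaguerre a j x ^ 2) volume 0 R :=
      fun j => ((continuous_scaledLaguerre a j).pow 2).intervalIntegrable _ _
    have hint := intervalIntegral.integral_eq_sub_of_hasDerivAt hd ((hc (k + 1)).sub (hc k))
    rw [intervalIntegral.integral_sub (hc _) (hc _)] at hint
    have h0 : scaledLaguerre a (k + 1) 0 - scaledLaguerre a k 0 = 0 := by
      simp [scaledLaguerre, laguerreL_zero_right]
    rw [h0] at hint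
    have : 0 ≤ 1 / a * (scaledLaguerre a (k + 1) R - scaledLaguerre a k R) ^ 2 := by positivity
    linarith

theorem integrableOn_scaledLaguerre_sq {a : ℝ} (ha : 0 < a) (k : ℕ) :
    IntegrableOn (fun x => scaledLaguerre a k x ^ 2) (Ioi 0) := by
  refine integrableOn_Ioi_of_intervalIntegral_norm_bounded 1 0
    (fun i : ℝ => (((continuous_scaledLaguerre a k).pow 2).integrableOn_Icc).mono_set
      Ioc_subset_Icc_self) tendsto_id ?_
  exact Eventually.of_forall fun R => by simpa using integral_scaledLaguerre_sq_le_one ha k R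

theorem integral_Ioi_scaledLaguerre_sq_le_one {a : ℝ} (ha : 0 < a) (k : ℕ) :
    ∫ x in Ioi (0 : ℝ), scaledLaguerre a k x ^ 2 ≤ 1 := by
  refine le_of_tendsto (intervalIntegral_tendsto_integral_Ioi 0
    (integrableOn_scaledLaguerre_sq ha k) tendsto_id) ?_
  exact Eventually.of_forall fun R => integral_scaledLaguerre_sq_le_one ha k R

/-! ### Rapid decay and the Schwartz class of the half line -/

/-- A function that decays faster than every power on the half line `[0, ∞)`. -/
def RapidOnHalfLine (f : ℝ → ℂ) : Prop :=
  ∀ n : ℕ, ∃ C : ℝ, ∀ x, 0 ≤ x → (1 + x) ^ n * ‖f x‖ ≤ C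

namespace RapidOnHalfLine

variable {f g : ℝ → ℂ}

theorem add (hf : RapidOnHalfLine f) (hg : RapidOnHalfLine g) :
    RapidOnHalfLine fun x => f x + g x := by
  intro n
  obtain ⟨C, hC⟩ := hf n
  obtain ⟨D, hD⟩ := hg n
  refine ⟨C + D, fun x hx => ?_⟩
  calc (1 + x) ^ n * ‖f x + g x‖ ≤ (1 + x) ^ n * (‖f x‖ + ‖g x‖) := by
        gcongr; exact norm_add_le _ _
    _ ≤ C + D := by rw [mul_add]; exact add_le_add (hC x hx) (hD x hx)

theorem const_mul (c : ℂ) (hf : RapidOnHalfLine f) : RapidOnHalfLine fun x => c * f x := by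
  intro n
  obtain ⟨C, hC⟩ := hf n
  refine ⟨‖c‖ * C, fun x hx => ?_⟩
  rw [norm_mul, mul_left_comm]
  exact mul_le_mul_of_nonneg_left (hC x hx) (norm_nonneg _)

theorem mul_polyBounded {u : ℝ → ℝ} (hf : RapidOnHalfLine f) (hu : PolyBoundedOnHalfLine u) :
    RapidOnHalfLine fun x => f x * u x := by
  intro n
  obtain ⟨D, m, hD⟩ := hu
  obtain ⟨C, hC⟩ := hf (n + m)
  refine ⟨C * |D|, fun x hx => ?_⟩
  have h1 : |u x| ≤ (1 + x) ^ m * |D| := (hD x hx).trans (by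
    rw [mul_comm]; gcongr; exact le_abs_self D)
  calc (1 + x) ^ n * ‖f x * u x‖ = (1 + x) ^ n * (‖f x‖ * |u x|) := by simp
    _ ≤ (1 + x) ^ n * (‖f x‖ * ((1 + x) ^ m * |D|)) := by gcongr
    _ = ((1 + x) ^ (n + m) * ‖f x‖) * |D| := by rw [pow_add]; ring
    _ ≤ C * |D| := by gcongr; exact hC x hx

theorem tendsto_zero (hf : RapidOnHalfLine f) : Tendsto f atTop (𝓝 0) := by
  obtain ⟨C, hC⟩ := hf 1
  rw [tendsto_zero_iff_norm_tendsto_zero]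
  have hlim : Tendsto (fun x : ℝ => C / (1 + x)) atTop (𝓝 0) :=
    (tendsto_atTop_add_const_left atTop 1 tendsto_id).const_div_atTop C
  refine squeeze_zero' (Eventually.of_forall fun _ => norm_nonneg _) ?_ hlim
  filter_upwards [eventually_ge_atTop 0] with x hx
  rw [le_div_iff₀ (by linarith), mul_comm]
  simpa using hC x hx

theorem integrableOn (hf : RapidOnHalfLine f) (hc : Continuous f) : IntegrableOn f (Ioi 0) := by
  obtain ⟨C, hC⟩ := hf 2
  have hint : IntegrableOn (fun x : ℝ => C * (1 + x ^ 2)⁻¹) (Ioi 0) :=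
    (integrable_inv_one_add_sq.const_mul C).integrableOn
  refine hint.mono' hc.aestronglyMeasurable ?_
  filter_upwards [ae_restrict_mem measurableSet_Ioi] with x hx
  have hx : 0 < x := hx
  rw [← div_eq_mul_inv, le_div_iff₀ (by positivity), mul_comm]
  refine le_trans ?_ (hC x hx.le)
  gcongr
  nlinarith

theorem integrableOn_norm_sq (hf : RapidOnHalfLine f) (hc : Continuous f) :
    IntegrableOn (fun x => ‖f x‖ ^ 2) (Ioi 0) := by
  obtain ⟨C, hC⟩ := hf 0
  refine ((hf.integrableOn hc).norm.const_mul C).mono' (hc.norm.pow 2).aestronglyMeasurable ?_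
  filter_upwards [ae_restrict_mem measurableSet_Ioi] with x hx
  have h := hC x (le_of_lt hx)
  rw [pow_zero, one_mul] at h
  rw [norm_pow, norm_norm, sq]
  gcongr

end RapidOnHalfLine

/-- Smooth functions all of whose derivatives decay faster than every power on `[0, ∞)`. -/
def HalfLineSchwartz (f : ℝ → ℂ) : Prop :=
  ∃ F : ℕ → ℝ → ℂ, F 0 = f ∧ (∀ j x, HasDerivAt (F j) (F (j + 1) x) x) ∧
    ∀ j, RapidOnHalfLine (F j)

namespace HalfLineSchwartz

variable {f g : ℝ → ℂ}

theorem rapid (hf : HalfLineSchwartz f) : RapidOnHalfLine f := by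
  obtain ⟨F, rfl, -, h⟩ := hf
  exact h 0

theorem continuous (hf : HalfLineSchwartz f) : Continuous f := by
  obtain ⟨F, rfl, h, -⟩ := hf
  exact continuous_iff_continuousAt.2 fun x => (h 0 x).continuousAt

theorem exists_deriv (hf : HalfLineSchwartz f) :
    ∃ g, HalfLineSchwartz g ∧ ∀ x, HasDerivAt f (g x) x := by
  obtain ⟨F, rfl, h, h'⟩ := hf
  exact ⟨F 1, ⟨fun j => F (j + 1), rfl, fun j => h (j + 1), fun j => h' (j + 1)⟩, h 0⟩

theorem add (hf : HalfLineSchwartz f) (hg : HalfLineSchwartz g) :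
    HalfLineSchwartz fun x => f x + g x := by
  obtain ⟨F, rfl, hF, hF'⟩ := hf
  obtain ⟨G, rfl, hG, hG'⟩ := hg
  exact ⟨fun j x => F j x + G j x, rfl, fun j x => (hF j x).add (hG j x),
    fun j => (hF' j).add (hG' j)⟩

theorem const_mul (c : ℂ) (hf : HalfLineSchwartz f) : HalfLineSchwartz fun x => c * f x := by
  obtain ⟨F, rfl, hF, hF'⟩ := hf
  exact ⟨fun j x => c * F j x, rfl, fun j x => (hF j x).const_mul c, fun j => (hF' j).const_mul c⟩

theorem mul_id (hf : HalfLineSchwartz f) : HalfLineSchwartz fun x => f x * (x : ℂ) := by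
  obtain ⟨F, rfl, hF, hF'⟩ := hf
  -- Leibniz rule; at `j = 0` the truncated index `j - 1` is harmless because its coefficient is
  -- zero.
  refine ⟨fun j x => F j x * (x : ℂ) + j * F (j - 1) x, by ext; simp, fun j x => ?_,
    fun j => ((hF' j).mul_polyBounded .id).add ((hF' _).const_mul _)⟩
  have hid : HasDerivAt (fun x : ℝ => (x : ℂ)) 1 x := (hasDerivAt_id x).ofReal_comp
  refine (((hF j x).mul hid).add ((hF (j - 1) x).const_mul (j : ℂ))).congr_deriv ?_
  cases j with
  | zero => simp
  | succ j => simp; ring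

end HalfLineSchwartz

/-! ### Decay of Laguerre coefficients -/

theorem integrableOn_mul_scaledLaguerre {a : ℝ} (ha : 0 < a) {f : ℝ → ℂ}
    (hf : HalfLineSchwartz f) (k : ℕ) :
    IntegrableOn (fun x => f x * (scaledLaguerre a k x : ℂ)) (Ioi 0) :=
  (hf.rapid.mul_polyBounded (polyBounded_scaledLaguerre ha.le k)).integrableOn
    (hf.continuous.mul (Complex.continuous_ofReal.comp (continuous_scaledLaguerre a k)))

/-- The Laguerre coefficients of a function in the Schwartz class of the half line are bounded. -/
theorem exists_bound_integral_mul_scaledLaguerre {a : ℝ} (ha : 0 < a) {f : ℝ → ℂ}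
    (hf : HalfLineSchwartz f) :
    ∃ C : ℝ, ∀ k, ‖∫ x in Ioi (0 : ℝ), f x * (scaledLaguerre a k x : ℂ)‖ ≤ C := by
  -- The pointwise bound `|f h| ≤ |f|² + h²` replaces Cauchy–Schwarz.
  refine ⟨(∫ x in Ioi (0 : ℝ), ‖f x‖ ^ 2) + 1, fun k => ?_⟩
  have h1 := hf.rapid.integrableOn_norm_sq hf.continuous
  have h2 := integrableOn_scaledLaguerre_sq ha k
  calc ‖∫ x in Ioi (0 : ℝ), f x * (scaledLaguerre a k x : ℂ)‖
      ≤ ∫ x in Ioi (0 : ℝ), (‖f x‖ ^ 2 + scaledLaguerre a k x ^ 2) := by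
        refine norm_integral_le_of_norm_le (h1.add h2) (Eventually.of_forall fun x => ?_)
        rw [norm_mul, Complex.norm_real, Real.norm_eq_abs,
          ← sq_abs (scaledLaguerre a k x)]
        nlinarith [sq_nonneg (‖f x‖ - |scaledLaguerre a k x|), sq_nonneg ‖f x‖,
          sq_nonneg |scaledLaguerre a k x|]
    _ = (∫ x in Ioi (0 : ℝ), ‖f x‖ ^ 2) + ∫ x in Ioi (0 : ℝ), scaledLaguerre a k x ^ 2 :=
        integral_add h1 h2
    _ ≤ _ := by gcongr; exact integral_Ioi_scaledLaguerre_sq_le_one ha k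

/-- The Laguerre operator is symmetric, with the Laguerre functions as eigenfunctions. -/
theorem exists_integral_mul_scaledLaguerre_eq {a : ℝ} (ha : 0 < a) {f : ℝ → ℂ}
    (hf : HalfLineSchwartz f) :
    ∃ g, HalfLineSchwartz g ∧ ∀ k : ℕ,
      ∫ x in Ioi (0 : ℝ), g x * (scaledLaguerre a k x : ℂ)
        = ((a * (k + 1 / 2) : ℝ) : ℂ)
          * ∫ x in Ioi (0 : ℝ), f x * (scaledLaguerre a k x : ℂ) := by
  obtain ⟨f₁, hf₁, hd₁⟩ := hf.exists_deriv
  obtain ⟨f₂, hf₂, hd₂⟩ := hf₁.exists_deriv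
  -- The function `Lf = (a²x/4) f - (x f')'`, with the derivative expanded.
  have hg : HalfLineSchwartz fun x =>
      ((a ^ 2 / 4 : ℝ) : ℂ) * (f x * (x : ℂ)) + (-1) * (f₁ x + f₂ x * (x : ℂ)) :=
    (hf.mul_id.const_mul _).add ((hf₁.add hf₂.mul_id).const_mul _)
  refine ⟨_, hg, fun k => ?_⟩
  set μ : ℂ := ((a * (k + 1 / 2) : ℝ) : ℂ) with hμ
  set s := scaledLaguerre a k with hs
  have hgi := integrableOn_mul_scaledLaguerre ha hg k
  have hfi := (integrableOn_mul_scaledLaguerre ha hf k).const_mul μ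
  -- Lagrange identity: `f · x h' - x f' · h` has derivative `(Lf) h - μ f h`. It vanishes at `0`
  -- through the factor `x` and at infinity by rapid decay.
  have hW : ∀ x ∈ Ici (0 : ℝ), HasDerivAt
      (fun x => f x * (scaledLaguerreMulDeriv a k x : ℂ) + (-1) * (f₁ x * (x : ℂ) * (s x : ℂ)))
      ((((a ^ 2 / 4 : ℝ) : ℂ) * (f x * (x : ℂ)) + (-1) * (f₁ x + f₂ x * (x : ℂ))) * (s x : ℂ)
        - μ * (f x * (s x : ℂ))) x := by
    intro x _
    have hid : HasDerivAt (fun x : ℝ => (x : ℂ)) 1 x := (hasDerivAt_id x).ofReal_comp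
    have h := ((hd₁ x).mul (hasDerivAt_scaledLaguerreMulDeriv a k x).ofReal_comp).add
      ((((hd₂ x).mul hid).mul (hasDerivAt_scaledLaguerre a k x).ofReal_comp).const_mul (-1))
    refine h.congr_deriv ?_
    simp only [hμ, hs, scaledLaguerreMulDeriv, scaledLaguerre, Pi.mul_apply]
    push_cast
    ring
  have hlim : Tendsto
      (fun x => f x * (scaledLaguerreMulDeriv a k x : ℂ) + (-1) * (f₁ x * (x : ℂ) * (s x : ℂ)))
      atTop (𝓝 0) :=
    ((hf.rapid.mul_polyBounded (polyBounded_scaledLaguerreMulDeriv ha.le k)).add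
      ((hf₁.mul_id.rapid.mul_polyBounded (polyBounded_scaledLaguerre ha.le k)).const_mul
        (-1))).tendsto_zero
  have h := integral_Ioi_of_hasDerivAt_of_tendsto' hW (hgi.sub hfi) hlim
  rw [integral_sub hgi hfi, integral_const_mul] at h
  simpa [scaledLaguerreMulDeriv, sub_eq_zero] using h

/-- The Laguerre coefficients of a function in the Schwartz class of the half line decay faster
than every power. -/
theorem HalfLineSchwartz.exists_pow_mul_norm_integral_le {a : ℝ} (ha : 0 < a) (N : ℕ)
    {f : ℝ → ℂ} (hf : HalfLineSchwartz f) :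
    ∃ C : ℝ, ∀ k : ℕ,
      (k : ℝ) ^ N * ‖∫ x in Ioi (0 : ℝ), f x * (scaledLaguerre a k x : ℂ)‖ ≤ C := by
  induction N generalizing f with
  | zero => simpa using exists_bound_integral_mul_scaledLaguerre ha hf
  | succ N ih =>
    -- Passing from `f` to `Lf` gains the factor `a (k + 1/2) ≥ a k`, one power of `k`.
    obtain ⟨g, hg, hfg⟩ := exists_integral_mul_scaledLaguerre_eq ha hf
    obtain ⟨C, hC⟩ := ih hg
    refine ⟨C / a, fun k => ?_⟩
    have h := hC k
    rw [hfg, norm_mul, Complex.norm_real, Real.norm_of_nonneg (by positivity)] at h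
    rw [le_div_iff₀ ha]
    refine le_trans ?_ h
    set I := ‖∫ x in Ioi (0 : ℝ), f x * (scaledLaguerre a k x : ℂ)‖
    have hI : 0 ≤ I := norm_nonneg _
    calc (k : ℝ) ^ (N + 1) * I * a = (k : ℝ) ^ N * (a * k * I) := by ring
      _ ≤ (k : ℝ) ^ N * (a * (k + 1 / 2) * I) := by gcongr; linarith

/-! ### Fourier integrals along the line `ℝ + i` -/

/-- Measurable functions that are integrable against every exponential weight. -/
structure ExpIntegrable (H : ℝ → ℂ) : Prop where
  meas : AEStronglyMeasurable H volume
  integrable_exp : ∀ r : ℝ, Integrable fun t : ℝ => Real.exp (r * |t|) * ‖H t‖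

/-- The Fourier integral of `H` along the shifted line `ℝ + i`. -/
noncomputable def shiftedFourier (H : ℝ → ℂ) (z : ℂ) : ℂ :=
  ∫ t : ℝ, H t * Complex.exp (Complex.I * z * (t + Complex.I))

theorem norm_exp_I_mul_mul_add_I (z : ℂ) (t : ℝ) :
    ‖Complex.exp (Complex.I * z * (t + Complex.I))‖ = Real.exp (-(z.im * t) - z.re) := by
  rw [Complex.norm_exp]
  simp

theorem norm_I_mul_add_I_le (t : ℝ) : ‖Complex.I * (t + Complex.I)‖ ≤ Real.exp |t| := by
  rw [norm_mul, Complex.norm_I, one_mul]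
  refine (norm_add_le _ _).trans ?_
  rw [Complex.norm_I, Complex.norm_real, Real.norm_eq_abs]
  exact Real.add_one_le_exp _

namespace ExpIntegrable

variable {H : ℝ → ℂ}

theorem integrable (hH : ExpIntegrable H) : Integrable H := by
  have h := hH.integrable_exp 0
  simp only [zero_mul, Real.exp_zero, one_mul] at h
  exact (integrable_norm_iff hH.meas).1 h

/-- Each differentiation of the Fourier integral brings down `i(t + i)`, whose modulus is at most
`e^{|t|}`; raising the exponential rate by one absorbs it. -/
theorem mul_I_mul_add_I (hH : ExpIntegrable H) :
    ExpIntegrable fun t => Complex.I * (t + Complex.I) * H t := by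
  have hm : AEStronglyMeasurable (fun t : ℝ => Complex.I * (t + Complex.I) * H t) volume :=
    (by fun_prop : Continuous fun t : ℝ => Complex.I * (t + Complex.I)).aestronglyMeasurable.mul
      hH.meas
  refine ⟨hm, fun r => (hH.integrable_exp (r + 1)).mono' ?_ (Eventually.of_forall fun t => ?_)⟩
  · exact (by fun_prop : Continuous fun t : ℝ => Real.exp (r * |t|)).aestronglyMeasurable.mul
      hm.norm
  · rw [Real.norm_of_nonneg (by positivity), norm_mul, add_mul, Real.exp_add, one_mul, mul_assoc]
    gcongr
    exact norm_I_mul_add_I_le t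

/-- Differentiation under the integral: on the unit ball about `z` the imaginary part grows by at
most one, and the second `+ 1` in the dominating rate pays for `i(t + i)`. -/
theorem hasDerivAt_shiftedFourier (hH : ExpIntegrable H) (z : ℂ) :
    HasDerivAt (shiftedFourier H)
      (shiftedFourier (fun t => Complex.I * (t + Complex.I) * H t) z) z := by
  have hmeas : ∀ w : ℂ, AEStronglyMeasurable
      (fun t : ℝ => H t * Complex.exp (Complex.I * w * (t + Complex.I))) volume := fun w =>
    hH.meas.mul (by fun_prop : Continuous fun t : ℝ =>
      Complex.exp (Complex.I * w * (t + Complex.I))).aestronglyMeasurable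
  have hnorm : ∀ w ∈ Metric.ball z 1, ∀ t : ℝ,
      ‖Complex.exp (Complex.I * w * (t + Complex.I))‖
        ≤ Real.exp (1 - z.re) * Real.exp ((|z.im| + 1) * |t|) := by
    intro w hw t
    rw [norm_exp_I_mul_mul_add_I, ← Real.exp_add, Real.exp_le_exp]
    rw [mem_ball_iff_norm] at hw
    have h1 := (Complex.abs_re_le_norm (w - z)).trans hw.le
    have h2 := (Complex.abs_im_le_norm (w - z)).trans hw.le
    rw [Complex.sub_re, abs_le] at h1
    rw [Complex.sub_im] at h2
    have h3 : |w.im| ≤ |z.im| + 1 := by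
      have := abs_sub_abs_le_abs_sub w.im z.im
      linarith
    have h4 : -(w.im * t) ≤ (|z.im| + 1) * |t| := by
      refine (neg_le_abs _).trans ?_
      rw [abs_mul]
      gcongr
    linarith [h1.1]
  refine (hasDerivAt_integral_of_dominated_loc_of_deriv_le
    (F := fun w (t : ℝ) => H t * Complex.exp (Complex.I * w * (t + Complex.I)))
    (F' := fun w (t : ℝ) => Complex.I * (t + Complex.I) * H t *
      Complex.exp (Complex.I * w * (t + Complex.I)))
    (bound := fun t => Real.exp (1 - z.re) * (Real.exp ((|z.im| + 1 + 1) * |t|) * ‖H t‖))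
    (Metric.ball_mem_nhds z one_pos) (Eventually.of_forall hmeas) ?_ ?_ ?_ ?_ ?_).2
  · refine ((hH.integrable_exp (|z.im| + 1)).const_mul (Real.exp (1 - z.re))).mono' (hmeas z)
      (Eventually.of_forall fun t => ?_)
    rw [norm_mul, mul_comm, ← mul_assoc]
    gcongr
    exact hnorm z (Metric.mem_ball_self one_pos) t
  · exact (hH.mul_I_mul_add_I.meas).mul (by fun_prop : Continuous fun t : ℝ =>
      Complex.exp (Complex.I * z * (t + Complex.I))).aestronglyMeasurable
  · refine Eventually.of_forall fun t w hw => ?_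
    rw [norm_mul, norm_mul, add_mul _ 1, one_mul, Real.exp_add]
    calc _ ≤ Real.exp |t| * ‖H t‖ *
          (Real.exp (1 - z.re) * Real.exp ((|z.im| + 1) * |t|)) := by
            gcongr
            · exact norm_I_mul_add_I_le t
            · exact hnorm w hw t
      _ = _ := by ring
  · exact (hH.integrable_exp _).const_mul _
  · refine Eventually.of_forall fun t w _ => ?_
    have h := ((((hasDerivAt_id w).const_mul Complex.I).mul_const
      ((t : ℂ) + Complex.I)).cexp).const_mul (H t)
    refine h.congr_deriv ?_
    simp only [id]
    ring

/-- This is what the shift by `i` achieves: for real `x` the kernel has modulus `e^{-x}`, which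
beats every power. -/
theorem rapidOnHalfLine_shiftedFourier (hH : ExpIntegrable H) :
    RapidOnHalfLine fun x => shiftedFourier H x := by
  intro n
  refine ⟨n.factorial * Real.exp 1 * ∫ t, ‖H t‖, fun x hx => ?_⟩
  have h1 : ‖shiftedFourier H x‖ ≤ Real.exp (-x) * ∫ t, ‖H t‖ := by
    rw [← integral_const_mul]
    refine norm_integral_le_of_norm_le (hH.integrable.norm.const_mul _)
      (Eventually.of_forall fun t => ?_)
    rw [norm_mul, norm_exp_I_mul_mul_add_I, mul_comm]
    simp
  have h2 : (1 + x) ^ n ≤ n.factorial * Real.exp (1 + x) := by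
    have := Real.pow_div_factorial_le_exp (1 + x) (by linarith) n
    rwa [div_le_iff₀ (by positivity), mul_comm] at this
  calc (1 + x) ^ n * ‖shiftedFourier H x‖
      ≤ (n.factorial * Real.exp (1 + x)) * (Real.exp (-x) * ∫ t, ‖H t‖) := by gcongr
    _ = n.factorial * (Real.exp (1 + x) * Real.exp (-x)) * ∫ t, ‖H t‖ := by ring
    _ = _ := by rw [← Real.exp_add, add_neg_cancel_right]

theorem halfLineSchwartz_shiftedFourier (hH : ExpIntegrable H) :
    HalfLineSchwartz fun x => shiftedFourier H x := by
  set G : ℕ → ℝ → ℂ := fun j => (fun (K : ℝ → ℂ) (t : ℝ) => Complex.I * (t + Complex.I) * K t)^[j] H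
    with hG
  have hsucc : ∀ j, G (j + 1) = fun t => Complex.I * (t + Complex.I) * G j t := fun j => by
    rw [hG]
    exact Function.iterate_succ_apply' _ j H
  have hexp : ∀ j, ExpIntegrable (G j) := by
    intro j
    induction j with
    | zero => exact hH
    | succ j ih => rw [hsucc]; exact ih.mul_I_mul_add_I
  refine ⟨fun j x => shiftedFourier (G j) x, rfl, fun j x => ?_,
    fun j => (hexp j).rapidOnHalfLine_shiftedFourier⟩
  simp only [hsucc]
  exact ((hexp j).hasDerivAt_shiftedFourier x).comp_ofReal

end ExpIntegrable

/-! ### Fourier uniqueness -/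

open FourierTransform in
/-- An integrable function with vanishing Fourier transform is zero almost everywhere. -/
theorem ae_eq_zero_of_fourier_eq_zero {f : ℝ → ℂ} (hf : Integrable f)
    (h : ∀ x : ℝ, ∫ t : ℝ, f t * Complex.exp (Complex.I * x * t) = 0) : ∀ᵐ t, f t = 0 := by
  have hF : 𝓕 f = 0 := by
    ext w
    rw [Real.fourier_real_eq_integral_exp_smul, Pi.zero_apply, ← h (-2 * Real.pi * w)]
    refine integral_congr_ae (Eventually.of_forall fun t => ?_)
    simp only [smul_eq_mul]
    rw [mul_comm]
    congr 2
    push_cast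
    ring
  refine ae_eq_zero_of_integral_contDiff_smul_eq_zero hf.locallyIntegrable fun g hg hgs => ?_
  have hg₁ : HasCompactSupport (Complex.ofRealCLM ∘ g) := hgs.comp_left rfl
  have hg₂ : ContDiff ℝ (⊤ : ℕ∞) (Complex.ofRealCLM ∘ g) :=
    Complex.ofRealCLM.contDiff.comp hg
  set G : SchwartzMap ℝ ℂ := hg₁.toSchwartzMap hg₂ with hG
  have hK : 𝓕 ((𝓕⁻ G : SchwartzMap ℝ ℂ) : ℝ → ℂ) = G := by
    rw [← SchwartzMap.fourier_coe]
    simp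
  -- Multiplication formula `∫ 𝓕f · 𝓕⁻G = ∫ f · G`; the left side vanishes.
  have hflip := VectorFourier.integral_fourierIntegral_smul_eq_flip (L := innerₗ ℝ)
    Real.continuous_fourierChar continuous_inner hf (𝓕⁻ G : SchwartzMap ℝ ℂ).integrable
    (μ := volume) (ν := volume)
  have e1 : VectorFourier.fourierIntegral Real.fourierChar volume (innerₗ ℝ) f = 𝓕 f := rfl
  have e2 : VectorFourier.fourierIntegral Real.fourierChar volume (innerₗ ℝ).flip
      ((𝓕⁻ G : SchwartzMap ℝ ℂ) : ℝ → ℂ) = 𝓕 ((𝓕⁻ G : SchwartzMap ℝ ℂ) : ℝ → ℂ) := by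
    rw [flip_innerₗ]; rfl
  rw [e1, e2, hF, hK] at hflip
  simp only [Pi.zero_apply, zero_smul, integral_zero] at hflip
  rw [hflip]
  refine integral_congr_ae (Eventually.of_forall fun t => ?_)
  simp [hG, mul_comm]

/-- The integral is entire in `z`, so its vanishing spreads from the half line to all of `ℝ`. There
it equals `e^{-x}` times the ordinary Fourier integral of `H`. -/
theorem ExpIntegrable.ae_eq_zero_of_shiftedFourier_eq_zero {H : ℝ → ℂ} (hH : ExpIntegrable H)
    (h : ∀ᵐ x : ℝ ∂(volume.restrict (Ioi (0 : ℝ))), shiftedFourier H x = 0) : ∀ᵐ t, H t = 0 := by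
  have hdiff : Differentiable ℂ (shiftedFourier H) := fun z =>
    (hH.hasDerivAt_shiftedFourier z).differentiableAt
  have hcont : Continuous fun x : ℝ => shiftedFourier H x :=
    hdiff.continuous.comp Complex.continuous_ofReal
  have hzero : EqOn (fun x : ℝ => shiftedFourier H x) 0 (Ioi 0) :=
    Measure.eqOn_open_of_ae_eq h isOpen_Ioi hcont.continuousOn continuousOn_const
  have han : AnalyticOnNhd ℝ (fun x : ℝ => shiftedFourier H x) univ := fun x _ =>
    ((hdiff.analyticAt (x : ℂ)).restrictScalars (𝕜 := ℝ)).comp (Complex.ofRealCLM.analyticAt x)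
  have hall : ∀ x : ℝ, shiftedFourier H x = 0 := fun x =>
    han.eqOn_zero_of_preconnected_of_eventuallyEq_zero isPreconnected_univ (mem_univ 1)
      (hzero.eventuallyEq_of_mem (Ioi_mem_nhds one_pos)) (mem_univ x)
  refine ae_eq_zero_of_fourier_eq_zero hH.integrable fun x => ?_
  have hx := hall x
  have heq : ∀ t : ℝ, H t * Complex.exp (Complex.I * x * (t + Complex.I))
      = H t * Complex.exp (Complex.I * x * t) * Complex.exp (-x) := fun t => by
    rw [mul_assoc (H t), ← Complex.exp_add]
    congr 2
    linear_combination (x : ℂ) * Complex.I_mul_I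
  rw [shiftedFourier, integral_congr_ae (Eventually.of_forall heq), integral_mul_const,
    mul_eq_zero] at hx
  exact hx.resolve_right (Complex.exp_ne_zero _)

/-! ### Contour shift for the Airy function -/

/-- The exponential `e^{i (z³ / 3 + x z)}` of the Airy integral. -/
noncomputable def airyPhase (x : ℝ) (z : ℂ) : ℂ :=
  Complex.exp (Complex.I * (z ^ 3 / 3 + x * z))

theorem continuous_airyPhase (x : ℝ) : Continuous (airyPhase x) := by
  unfold airyPhase
  fun_prop

/-- The term `-u² y` gives Gaussian decay on every horizontal line above the real axis. -/
theorem norm_airyPhase (x u y : ℝ) :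
    ‖airyPhase x (u + y * Complex.I)‖ = Real.exp (-(u ^ 2 * y) + y ^ 3 / 3 - x * y) := by
  rw [airyPhase, Complex.norm_exp]
  congr 1
  have : Complex.I * (((u : ℂ) + y * Complex.I) ^ 3 / 3 + x * (u + y * Complex.I))
      = ((-(u ^ 2 * y) + y ^ 3 / 3 - x * y : ℝ) : ℂ)
        + ((u ^ 3 / 3 - u * y ^ 2 + x * u : ℝ) : ℂ) * Complex.I := by
    push_cast
    have h3 : Complex.I ^ 3 = -Complex.I := Complex.I_pow_three
    have h4 : Complex.I ^ 4 = 1 := Complex.I_pow_four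
    ring_nf
    rw [h3, h4, Complex.I_sq]
    ring
  rw [this, Complex.add_re, Complex.re_ofReal_mul, Complex.I_re, mul_zero, add_zero,
    Complex.ofReal_re]

theorem norm_airyPhase_add_I (x t : ℝ) :
    ‖airyPhase x (t + Complex.I)‖ = Real.exp (1 / 3 - x) * Real.exp (-t ^ 2) := by
  have h := norm_airyPhase x t 1
  rw [Complex.ofReal_one, one_mul] at h
  rw [h, ← Real.exp_add]
  congr 1
  ring

theorem expIntegrable_airyPhase_mul (x : ℝ) {Ψ : ℝ → ℂ} (hΨ : AEStronglyMeasurable Ψ volume)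
    {C : ℝ} (hC : ∀ t, ‖Ψ t‖ ≤ C) :
    ExpIntegrable fun t => airyPhase x (t + Complex.I) * Ψ t := by
  have hm : AEStronglyMeasurable (fun t : ℝ => airyPhase x (t + Complex.I) * Ψ t) volume :=
    ((continuous_airyPhase x).comp
      (by fun_prop : Continuous fun t : ℝ => (t : ℂ) + Complex.I)).aestronglyMeasurable.mul hΨ
  refine ⟨hm, fun r => ?_⟩
  -- Half of the Gaussian absorbs the weight, by `r|t| ≤ r²/2 + t²/2`.
  refine ((integrable_exp_neg_mul_sq (b := 1 / 2) (by norm_num)).const_mul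
    (Real.exp (r ^ 2 / 2 + 1 / 3 - x) * C)).mono' ?_ (Eventually.of_forall fun t => ?_)
  · exact (by fun_prop : Continuous fun t : ℝ => Real.exp (r * |t|)).aestronglyMeasurable.mul
      hm.norm
  · rw [Real.norm_of_nonneg (by positivity), norm_mul, norm_airyPhase_add_I]
    have h1 : Real.exp (r * |t|) * (Real.exp (1 / 3 - x) * Real.exp (-t ^ 2))
        ≤ Real.exp (r ^ 2 / 2 + 1 / 3 - x) * Real.exp (-(1 / 2) * t ^ 2) := by
      rw [← Real.exp_add, ← Real.exp_add, ← Real.exp_add, Real.exp_le_exp]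
      nlinarith [sq_nonneg (r - |t|), sq_abs t]
    calc _ = Real.exp (r * |t|) * (Real.exp (1 / 3 - x) * Real.exp (-t ^ 2)) * ‖Ψ t‖ := by ring
      _ ≤ Real.exp (r ^ 2 / 2 + 1 / 3 - x) * Real.exp (-(1 / 2) * t ^ 2) * C := by
        gcongr
        exact hC t
      _ = _ := by ring

theorem integrable_airyPhase_add_I (x : ℝ) :
    Integrable fun t : ℝ => airyPhase x (t + Complex.I) := by
  simpa using (expIntegrable_airyPhase_mul x (Ψ := fun _ => 1) aestronglyMeasurable_const
    (C := 1) (by simp)).integrable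

/-- The integrand is at most a constant times `exp (-w² y)`, which tends to `0` for each `y > 0`;
dominated convergence suffices. The general `w` covers both sides `±R` of the rectangle. -/
theorem tendsto_integral_airyPhase_vertical (x : ℝ) {w : ℝ → ℝ}
    (hw : Tendsto (fun R => w R ^ 2) atTop atTop) :
    Tendsto (fun R => ∫ y in (0 : ℝ)..1, airyPhase x (w R + y * Complex.I)) atTop (𝓝 0) := by
  have hcont : ∀ R, Continuous fun y : ℝ => airyPhase x (w R + y * Complex.I) := fun R =>
    (continuous_airyPhase x).comp (by fun_prop)
  have hle : ∀ R, ∀ y ∈ uIoc (0 : ℝ) 1, ‖airyPhase x (w R + y * Complex.I)‖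
      ≤ Real.exp (1 / 3 + |x|) * Real.exp (-(w R ^ 2 * y)) := by
    intro R y hy
    rw [uIoc_of_le zero_le_one] at hy
    rw [norm_airyPhase, ← Real.exp_add, Real.exp_le_exp]
    have h1 : y ^ 3 ≤ 1 := pow_le_one₀ hy.1.le hy.2
    have h2 : -(x * y) ≤ |x| := by
      refine (neg_le_abs _).trans ?_
      rw [abs_mul, abs_of_pos hy.1]
      exact mul_le_of_le_one_right (abs_nonneg _) hy.2
    linarith
  have hzero : ∫ _ in (0 : ℝ)..1, (0 : ℂ) = 0 := intervalIntegral.integral_zero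
  rw [← hzero]
  refine intervalIntegral.tendsto_integral_filter_of_dominated_convergence
    (fun _ => Real.exp (1 / 3 + |x|)) ?_ ?_ ?_ ?_
  · exact Eventually.of_forall fun R => (hcont R).aestronglyMeasurable
  · refine Eventually.of_forall fun R => Eventually.of_forall fun y hy => ?_
    refine (hle R y hy).trans (mul_le_of_le_one_right (Real.exp_pos _).le ?_)
    rw [Real.exp_le_one_iff, Left.neg_nonpos_iff]
    rw [uIoc_of_le zero_le_one] at hy
    exact mul_nonneg (sq_nonneg _) hy.1.le
  · exact intervalIntegrable_const
  · refine Eventually.of_forall fun y hy => ?_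
    have hy0 : 0 < y := by rw [uIoc_of_le zero_le_one] at hy; exact hy.1
    have hlim : Tendsto (fun R => Real.exp (1 / 3 + |x|) * Real.exp (-(w R ^ 2 * y)))
        atTop (𝓝 0) := by
      rw [← mul_zero (Real.exp (1 / 3 + |x|))]
      exact (Real.tendsto_exp_atBot.comp
        (tendsto_neg_atTop_atBot.comp (hw.atTop_mul_const hy0))).const_mul _
    exact squeeze_zero_norm (fun R => hle R y hy) hlim

theorem integral_airyPhase_rectangle (x R : ℝ) :
    ∫ t in (-R)..R, airyPhase x t = (∫ t in (-R)..R, airyPhase x (t + Complex.I))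
      - Complex.I * (∫ y in (0 : ℝ)..1, airyPhase x (R + y * Complex.I))
      + Complex.I * ∫ y in (0 : ℝ)..1, airyPhase x ((-R : ℝ) + y * Complex.I) := by
  have h := Complex.integral_boundary_rect_eq_zero_of_differentiableOn (airyPhase x)
    ((-R : ℝ) : ℂ) (R + Complex.I)
    (by unfold airyPhase; exact (by fun_prop : Differentiable ℂ _).differentiableOn)
  simp only [Complex.ofReal_re, Complex.ofReal_im, Complex.add_re, Complex.add_im, Complex.I_re,
    Complex.I_im, add_zero, zero_add, Complex.ofReal_zero, zero_mul, Complex.ofReal_one, one_mul,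
    smul_eq_mul] at h
  linear_combination h

theorem integral_airyPhase_symm (x R : ℝ) :
    ∫ t in (-R)..R, airyPhase x t
      = 2 * ((∫ t in (0 : ℝ)..R, Real.cos (t ^ 3 / 3 + x * t) : ℝ) : ℂ) := by
  have hc : Continuous fun t : ℝ => airyPhase x t :=
    (continuous_airyPhase x).comp Complex.continuous_ofReal
  have hneg : ∫ t in (-R)..0, airyPhase x t = ∫ t in (0 : ℝ)..R, airyPhase x ((-t : ℝ) : ℂ) := by
    rw [intervalIntegral.integral_comp_neg (fun t : ℝ => airyPhase x t), neg_zero]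
  have hc' : Continuous fun t : ℝ => airyPhase x ((-t : ℝ) : ℂ) := hc.comp continuous_neg
  rw [← intervalIntegral.integral_add_adjacent_intervals (hc.intervalIntegrable (-R) 0)
    (hc.intervalIntegrable 0 R), hneg, ← intervalIntegral.integral_add
    (hc'.intervalIntegrable _ _) (hc.intervalIntegrable _ _), ← intervalIntegral.integral_ofReal,
    ← intervalIntegral.integral_const_mul]
  refine intervalIntegral.integral_congr fun t _ => ?_
  simp only [airyPhase]
  push_cast
  rw [Complex.two_cos, add_comm]
  congr 2 <;> ring

/-- The absolutely convergent integral representation of the Airy function on `ℝ + i`. -/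
theorem airyAi_eq_integral (x : ℝ) :
    (airyAi x : ℂ) = (1 / (2 * Real.pi) : ℝ) * ∫ t : ℝ, airyPhase x (t + Complex.I) := by
  set J := ∫ t : ℝ, airyPhase x (t + Complex.I) with hJ
  have hsq : Tendsto (fun R : ℝ => R ^ 2) atTop atTop := tendsto_pow_atTop two_ne_zero
  have hlim : Tendsto (fun R : ℝ => ∫ t in (-R)..R, airyPhase x t) atTop (𝓝 J) := by
    have h1 := intervalIntegral_tendsto_integral (integrable_airyPhase_add_I x)
      tendsto_neg_atTop_atBot tendsto_id
    have h2 := (tendsto_integral_airyPhase_vertical x (w := fun R => R) hsq).const_mul Complex.I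
    have h3 := (tendsto_integral_airyPhase_vertical x (w := fun R => -R)
      (by simp [hsq])).const_mul Complex.I
    have h := (h1.sub h2).add h3
    simp only [mul_zero, sub_zero, add_zero] at h
    exact h.congr fun R => (integral_airyPhase_rectangle x R).symm
  have hcos : Tendsto (fun R : ℝ => ((∫ t in (0 : ℝ)..R, Real.cos (t ^ 3 / 3 + x * t) : ℝ) : ℂ))
      atTop (𝓝 (J / 2)) := by
    refine (hlim.div_const 2).congr fun R => ?_
    rw [integral_airyPhase_symm, mul_div_cancel_left₀ _ two_ne_zero]
  have hre : Tendsto (fun R : ℝ => ∫ t in (0 : ℝ)..R, Real.cos (t ^ 3 / 3 + x * t))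
      atTop (𝓝 (J / 2).re) := by
    exact ((Complex.continuous_re.tendsto _).comp hcos).congr fun R => Complex.ofReal_re _
  -- `J / 2` is a limit of real numbers, hence real.
  have hreal : (((J / 2).re : ℝ) : ℂ) = J / 2 :=
    tendsto_nhds_unique ((Complex.continuous_ofReal.tendsto _).comp hre) hcos
  rw [airyAi, hre.limUnder_eq]
  push_cast
  rw [hreal]
  field_simp

theorem airyPhase_add (x y : ℝ) (z : ℂ) :
    airyPhase (x + y) z = airyPhase x z * Complex.exp (Complex.I * y * z) := by
  rw [airyPhase, airyPhase, ← Complex.exp_add]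
  congr 1
  push_cast
  ring

/-! ### The Airy operator as a shifted Fourier integral -/

/-- The Fourier integral over the half line, evaluated on `ℝ + i`. -/
noncomputable def halfLineFourier (ψ : ℝ → ℝ) (t : ℝ) : ℂ :=
  ∫ y in Ioi (0 : ℝ), Complex.exp (Complex.I * y * (t + Complex.I)) * (ψ y : ℂ)

/-- An `L²` function need not be integrable on the half line; the factor `e^{-y}` from the contour
shift repairs this. -/
theorem integrableOn_exp_neg_mul {ψ : ℝ → ℝ} (hψ : MemLp ψ 2 (volume.restrict (Ioi (0 : ℝ)))) :
    IntegrableOn (fun y => Real.exp (-y) * ψ y) (Ioi 0) := by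
  have he : MemLp (fun y : ℝ => Real.exp (-y)) 2 (volume.restrict (Ioi (0 : ℝ))) := by
    rw [memLp_two_iff_integrable_sq (by fun_prop)]
    have := exp_neg_integrableOn_Ioi 0 (b := 2) two_pos
    refine this.congr (Eventually.of_forall fun y => ?_)
    simp only [← Real.exp_nat_mul]
    congr 1
    push_cast
    ring
  exact he.integrable_mul hψ

theorem norm_exp_I_mul_real_mul_add_I (y t : ℝ) :
    ‖Complex.exp (Complex.I * y * (t + Complex.I))‖ = Real.exp (-y) := by
  rw [norm_exp_I_mul_mul_add_I]
  simp

theorem exp_I_mul_real_mul_add_I (y t : ℝ) :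
    Complex.exp (Complex.I * y * (t + Complex.I))
      = Complex.exp (Complex.I * t * y) * (Real.exp (-y) : ℂ) := by
  rw [Complex.ofReal_exp, ← Complex.exp_add]
  congr 1
  push_cast
  linear_combination (y : ℂ) * Complex.I_mul_I

theorem norm_halfLineFourier_le (ψ : ℝ → ℝ) (t : ℝ) :
    ‖halfLineFourier ψ t‖ ≤ ∫ y in Ioi (0 : ℝ), |Real.exp (-y) * ψ y| := by
  refine (norm_integral_le_integral_norm _).trans_eq
    (integral_congr_ae (Eventually.of_forall fun y => ?_))
  simp only [norm_mul, norm_exp_I_mul_real_mul_add_I, Complex.norm_real, Real.norm_eq_abs,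
    abs_mul, Real.abs_exp]

theorem continuous_halfLineFourier {ψ : ℝ → ℝ}
    (hψ : MemLp ψ 2 (volume.restrict (Ioi (0 : ℝ)))) : Continuous (halfLineFourier ψ) := by
  refine continuous_of_dominated (bound := fun y => |Real.exp (-y) * ψ y|) (fun t => ?_)
    (fun t => Eventually.of_forall fun y => ?_) (integrableOn_exp_neg_mul hψ).abs
    (Eventually.of_forall fun y => by fun_prop)
  · exact (by fun_prop : Continuous fun y : ℝ =>
      Complex.exp (Complex.I * y * (t + Complex.I))).aestronglyMeasurable.mul
      (Complex.continuous_ofReal.comp_aestronglyMeasurable hψ.aestronglyMeasurable)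
  · simp only [norm_mul, norm_exp_I_mul_real_mul_add_I, Complex.norm_real, Real.norm_eq_abs,
      abs_mul, Real.abs_exp, le_refl]

/-- This is the Fourier integral of `e^{-y} ψ(y)` extended by zero, so Fourier uniqueness applies.
-/
theorem ae_eq_zero_of_halfLineFourier_eq_zero {ψ : ℝ → ℝ}
    (hψ : MemLp ψ 2 (volume.restrict (Ioi (0 : ℝ)))) (h : ∀ t, halfLineFourier ψ t = 0) :
    ψ =ᵐ[volume.restrict (Ioi (0 : ℝ))] 0 := by
  have hint : Integrable ((Ioi (0 : ℝ)).indicator fun y => ((Real.exp (-y) * ψ y : ℝ) : ℂ)) :=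
    IntegrableOn.integrable_indicator (integrableOn_exp_neg_mul hψ).ofReal measurableSet_Ioi
  have hzero := ae_eq_zero_of_fourier_eq_zero hint fun t => by
    rw [← h t, halfLineFourier, ← integral_indicator measurableSet_Ioi]
    refine integral_congr_ae (Eventually.of_forall fun y => ?_)
    by_cases hy : y ∈ Ioi (0 : ℝ)
    · simp only [indicator_of_mem hy, exp_I_mul_real_mul_add_I]
      push_cast
      ring
    · simp [indicator_of_notMem hy]
  rw [EventuallyEq, ae_restrict_iff' measurableSet_Ioi]
  filter_upwards [hzero] with y hy hmem
  rw [indicator_of_mem hmem, Complex.ofReal_eq_zero, mul_eq_zero] at hy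
  exact hy.resolve_left (Real.exp_pos _).ne'

/-- The density whose shifted Fourier integral is `T_c ψ`. -/
noncomputable def airyDensity (c : ℝ) (ψ : ℝ → ℝ) (t : ℝ) : ℂ :=
  airyPhase c (t + Complex.I) * (((1 / (2 * Real.pi) : ℝ) : ℂ) * halfLineFourier ψ t)

theorem expIntegrable_airyDensity (c : ℝ) {ψ : ℝ → ℝ}
    (hψ : MemLp ψ 2 (volume.restrict (Ioi (0 : ℝ)))) : ExpIntegrable (airyDensity c ψ) := by
  refine expIntegrable_airyPhase_mul c
    ((continuous_halfLineFourier hψ).const_mul _).aestronglyMeasurable (fun t => ?_)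
    (C := ‖((1 / (2 * Real.pi) : ℝ) : ℂ)‖ * ∫ y in Ioi (0 : ℝ), |Real.exp (-y) * ψ y|)
  rw [norm_mul]
  gcongr
  exact norm_halfLineFourier_le ψ t

/-- Fubini: the phase is multiplicative in `x + y + c`, and the double integrand has modulus `e^{-y}
|ψ(y)|` times a Gaussian in `t`. -/
theorem airyOperator_eq_shiftedFourier (c : ℝ) {ψ : ℝ → ℝ}
    (hψ : MemLp ψ 2 (volume.restrict (Ioi (0 : ℝ)))) (x : ℝ) :
    (airyOperator c ψ x : ℂ) = shiftedFourier (airyDensity c ψ) x := by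
  set ν := volume.restrict (Ioi (0 : ℝ)) with hν
  set κ : ℂ := ((1 / (2 * Real.pi) : ℝ) : ℂ) with hκ
  have hexp : ∀ y t : ℝ, airyPhase (x + y + c) (t + Complex.I) * (ψ y : ℂ)
      = Complex.exp (Complex.I * t * y)
        * (((Real.exp (-y) * ψ y : ℝ) : ℂ) * airyPhase (c + x) (t + Complex.I)) := fun y t => by
    rw [show x + y + c = c + x + y by ring, airyPhase_add, exp_I_mul_real_mul_add_I]
    push_cast
    ring
  have hint : Integrable (fun p : ℝ × ℝ =>
      airyPhase (x + p.1 + c) (p.2 + Complex.I) * (ψ p.1 : ℂ)) (ν.prod volume) := by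
    simp_rw [hexp]
    refine Integrable.bdd_mul (c := 1) ((integrableOn_exp_neg_mul hψ).ofReal.mul_prod
      (integrable_airyPhase_add_I (c + x)))
      (by fun_prop : Continuous fun p : ℝ × ℝ =>
        Complex.exp (Complex.I * p.2 * p.1)).aestronglyMeasurable
      (Eventually.of_forall fun p => ?_)
    rw [Complex.norm_exp]
    simp
  calc (airyOperator c ψ x : ℂ)
      = ∫ y, κ * (∫ t : ℝ, airyPhase (x + y + c) (t + Complex.I) * (ψ y : ℂ)) ∂ν := by
        rw [airyOperator, ← integral_complex_ofReal]
        refine integral_congr_ae (Eventually.of_forall fun y => ?_)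
        simp only
        rw [integral_mul_const]
        push_cast
        rw [airyAi_eq_integral, hκ]
        push_cast
        ring
    _ = κ * ∫ t : ℝ, (∫ y, airyPhase (x + y + c) (t + Complex.I) * (ψ y : ℂ) ∂ν) := by
        rw [integral_const_mul, integral_integral_swap hint]
    _ = shiftedFourier (airyDensity c ψ) x := by
        rw [← integral_const_mul, shiftedFourier]
        refine integral_congr_ae (Eventually.of_forall fun t => ?_)
        simp only
        have : ∀ y : ℝ, airyPhase (x + y + c) (t + Complex.I) * (ψ y : ℂ)
            = airyPhase (c + x) (t + Complex.I)
              * (Complex.exp (Complex.I * y * (t + Complex.I)) * (ψ y : ℂ)) := fun y => by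
          rw [show x + y + c = c + x + y by ring, airyPhase_add, mul_assoc]
        rw [integral_congr_ae (Eventually.of_forall this), integral_const_mul, airyPhase_add]
        simp only [airyDensity, halfLineFourier, hκ, hν]
        ring

/-! ### Injectivity, regularity of eigenfunctions and the conclusion -/

/-- The Airy integral operator is injective on `L²[0, ∞)`. -/
theorem ae_eq_zero_of_airyOperator_ae_eq_zero {c : ℝ} {ψ : ℝ → ℝ}
    (hψ : MemLp ψ 2 (volume.restrict (Ioi (0 : ℝ))))
    (h : ∀ᵐ x ∂(volume.restrict (Ioi (0 : ℝ))), airyOperator c ψ x = 0) :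
    ψ =ᵐ[volume.restrict (Ioi (0 : ℝ))] 0 := by
  have hH := (expIntegrable_airyDensity c hψ).ae_eq_zero_of_shiftedFourier_eq_zero (by
    filter_upwards [h] with x hx
    rw [← airyOperator_eq_shiftedFourier c hψ, hx, Complex.ofReal_zero])
  refine ae_eq_zero_of_halfLineFourier_eq_zero hψ fun t => ?_
  -- The exponential factor of the density never vanishes; continuity then upgrades almost
  -- everywhere to everywhere.
  have hae : halfLineFourier ψ =ᵐ[volume] fun _ => 0 := by
    filter_upwards [hH] with t ht
    have hpi : ((1 / (2 * Real.pi) : ℝ) : ℂ) ≠ 0 :=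
      Complex.ofReal_ne_zero.2 (by positivity)
    rw [airyDensity, airyPhase, mul_eq_zero, or_iff_right (Complex.exp_ne_zero _), mul_eq_zero,
      or_iff_right hpi] at ht
    exact ht
  exact congrFun (Measure.eq_of_ae_eq hae (continuous_halfLineFourier hψ) continuous_const) t

/-- Injectivity excludes `μ = 0`, so `ψ = μ⁻¹ T_c ψ` almost everywhere inherits the regularity of
the range of `T_c`. -/
theorem IsAiryEigenfunction.exists_halfLineSchwartz {c : ℝ} {ψ : ℝ → ℝ}
    (hψ : IsAiryEigenfunction c ψ) :
    ∃ f : ℝ → ℂ, HalfLineSchwartz f ∧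
      ∀ᵐ x ∂(volume.restrict (Ioi (0 : ℝ))), (ψ x : ℂ) = f x := by
  obtain ⟨μ, hμ⟩ := hψ.eigen
  have hμ0 : μ ≠ 0 := by
    rintro rfl
    exact hψ.ne_zero (ae_eq_zero_of_airyOperator_ae_eq_zero hψ.memLp (by simpa using hμ))
  refine ⟨_, (expIntegrable_airyDensity c hψ.memLp).halfLineSchwartz_shiftedFourier.const_mul
    (μ : ℂ)⁻¹, ?_⟩
  filter_upwards [hμ] with x hx
  rw [← airyOperator_eq_shiftedFourier c hψ.memLp, hx, Complex.ofReal_mul,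
    inv_mul_cancel_left₀ (Complex.ofReal_ne_zero.2 hμ0)]

/-- The coefficients of every eigenfunction of the Airy integral operator in the scaled Laguerre
functions decay super-algebraically: `k ^ N * |β_k| → 0` as `k → ∞`, for every `N : ℕ`. -/
theorem theorem3p2 (a c : ℝ) (ha : 0 < a) (ψ : ℝ → ℝ) (hψ : IsAiryEigenfunction c ψ) :
    Asymptotics.SuperpolynomialDecay atTop (fun k : ℕ => (k : ℝ))
      (fun k : ℕ => |laguerreCoeff a ψ k|) := by
  obtain ⟨f, hf, hψf⟩ := hψ.exists_halfLineSchwartz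
  have hcoeff : ∀ k, |laguerreCoeff a ψ k|
      = ‖∫ x in Ioi (0 : ℝ), f x * (scaledLaguerre a k x : ℂ)‖ := fun k => by
    rw [laguerreCoeff, ← Real.norm_eq_abs, ← Complex.norm_real, ← integral_complex_ofReal]
    congr 1
    refine integral_congr_ae ?_
    filter_upwards [hψf] with x hx
    rw [← hx]
    push_cast
    rfl
  intro N
  -- One extra power turns boundedness into the vanishing bound `C / k`.
  obtain ⟨C, hC⟩ := hf.exists_pow_mul_norm_integral_le ha (N + 1)
  refine squeeze_zero' (Eventually.of_forall fun k => by positivity) ?_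
    (tendsto_const_div_atTop_nhds_zero_nat C)
  filter_upwards [eventually_gt_atTop 0] with k hk
  rw [le_div_iff₀ (by exact_mod_cast hk), hcoeff]
  refine le_trans (le_of_eq ?_) (hC k)
  ring
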